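/- Let $N\ge 3$, let $\mathcal A=\{1,\dots,N\}$ be the set of actors, $\mathcal O=\{-1,+1\}$ the set of opinions, and $\mathcal S=\{u\in\mathbb Z^{N}:\min_{a\in\mathcal A}|u(a)|=0\}$ the set of lists of social pressures. For $a\in\mathcal A$, $\mathfrak o\in\mathcal O$ and $u\in\mathcal S$, let $\pi^{a,\mathfrak o}(u)\in\mathcal S$ be the list with $\pi^{a,\mathfrak o}(u)(a)=0$ and $\pi^{a,\mathfrak o}(u)(b)=u(b)+\mathfrak o$ for $b\ne a$. Fix $\beta\ge 0$ (the polarization coefficient). Given an initial list $u\in\mathcal S$, the process $(U_t^{\beta,u})$ evolves as follows. Put $T_0=0$ and $U_{T_0}^{\beta,u}=u$. For each $m\ge 0$, given the evolution up to time $T_m$, with current list $v=U_{T_m}^{\beta,u}$, independent exponential random times with parameters $\exp(\beta\,\mathfrak o\,v(a))$ are attached to the pairs $(a,\mathfrak o)\in\mathcal A\times\mathcal O$; let $(A_{m+1},O_{m+1})$ be the pair whose time is the smallest, let $T_{m+1}-T_m$ be that smallest time, and let $U_{T_{m+1}}^{\beta,u}=\pi^{A_{m+1},O_{m+1}}(v)$.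 Put $U_t^{\beta,u}=U_{T_m}^{\beta,u}$ for $T_m\le t<T_{m+1}$. Then, for every $\beta\ge 0$: 1. For every $u\in\mathcal S$, $\mathbb P(\sup\{T_m:m\ge 1\}=+\infty)=1$; consequently, almost surely, $U_t^{\beta,u}$ is defined for all $t\in[0,+\infty)$. 2. There is exactly one probability measure $\mu^{\beta}$ on $\mathcal S$ that is invariant for the process, that is, which satisfies $\sum_{u\in\mathcal S}\mu^{\beta}(u)\,\mathbb P(U_t^{\beta,u}=v)=\mu^{\beta}(v)$ for all $t\ge 0$ and all $v\in\mathcal S$. -/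

import Mathlib

open MeasureTheory ProbabilityTheory

namespace SocialPressure

noncomputable section

/-- The set `S` of lists of social pressures: integer lists indexed by the `N` actors in which some
entry is zero (equivalently, the minimum of the `|u a|` is `0`). -/
abbrev Lists (N : ℕ) : Type := {u : Fin N → ℤ // ∃ a, u a = 0}

/-- Opinions are `+1` and `-1`, realized as the units of `ℤ`. A mark is a pair (actor, opinion). -/
abbrev Mark (N : ℕ) : Type := Fin N × ℤˣ

/-- The map `π^{a,o}` on lists: the pressure on `a` is reset to `0`, and `o` is added to the
pressure on every other actor. -/
def push {N : ℕ} (i : Mark N) (u : Lists N) : Lists N :=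
  ⟨fun b => if b = i.1 then 0 else u.1 b + (i.2 : ℤ), i.1, by simp⟩

/-- The rate `exp (β o u(a))` at which the mark `(a, o)` occurs when the current list is `u`. -/
def rate {N : ℕ} (β : ℝ) (u : Lists N) (i : Mark N) : ℝ :=
  Real.exp (β * ((i.2 : ℤ) : ℝ) * (u.1 i.1 : ℝ))

/-- An outcome supplies, for every step `n`, every list `v` and every mark `i`, the random time
`ω (n, v, i)` attached to `i` after the `n`-th jump in case the list reached by that jump is `v`. -/
abbrev Clocks (N : ℕ) : Type := ℕ × Lists N × Mark N → ℝ

/-- The law of the clocks: they are independent, and `ω (n, v, i)` is exponential with parameter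
`rate β v i`. -/
def clockLaw (N : ℕ) (β : ℝ) : Measure (Clocks N) :=
  Measure.infinitePi fun k : ℕ × Lists N × Mark N => expMeasure (rate β k.2.1 k.2.2)

instance isProbabilityMeasure_expMeasure_rate {N : ℕ} (β : ℝ) (u : Lists N) (i : Mark N) :
    IsProbabilityMeasure (expMeasure (rate β u i)) :=
  isProbabilityMeasure_expMeasure (Real.exp_pos _)

instance isProbabilityMeasure_clockLaw (N : ℕ) (β : ℝ) :
    IsProbabilityMeasure (clockLaw N β) := by
  unfold clockLaw; infer_instance

theorem exists_first {N : ℕ} (v : Lists N) (τ : Mark N → ℝ) : ∃ i, ∀ j, τ i ≤ τ j := by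
  have : Nonempty (Fin N) := ⟨v.2.choose⟩
  exact Finite.exists_min τ

/-- The mark whose clock rings first after the `n`-th jump, when the current list is `v`. -/
def first {N : ℕ} (ω : Clocks N) (n : ℕ) (v : Lists N) : Mark N :=
  (exists_first v fun i => ω (n, v, i)).choose

/-- The list of social pressures after the `n`-th jump, started from `u`. -/
def chain {N : ℕ} (u : Lists N) (ω : Clocks N) : ℕ → Lists N
  | 0 => u
  | n + 1 => push (first ω n (chain u ω n)) (chain u ω n)

/-- The time `T n` of the `n`-th jump (with `T 0 = 0`): the waiting time between two successive
jumps is the smallest of the clocks attached to the current list. -/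
def jumpTime {N : ℕ} (u : Lists N) (ω : Clocks N) : ℕ → ℝ
  | 0 => 0
  | n + 1 => jumpTime u ω n + ω (n, chain u ω n, first ω n (chain u ω n))

open Classical in
/-- The process `U_t` started from `u`: it is the list reached at the `m`-th jump for
`T m ≤ t < T (m + 1)`, and is undefined (`none`) if there is no such `m`. -/
def process {N : ℕ} (u : Lists N) (t : ℝ) (ω : Clocks N) : Option (Lists N) :=
  if h : ∃ m, jumpTime u ω m ≤ t ∧ t < jumpTime u ω (m + 1) then
    some (chain u ω (Nat.find h))
  else none

/-- The transition kernel at time `t`: the mass that it gives to a list `v` from a list `u` is the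
probability that the process started from `u` is defined at time `t` and equals `v`. -/
def transition (N : ℕ) (β t : ℝ) : Kernel (Lists N) (Lists N) :=
  Kernel.ofFunOfCountable fun u =>
    Measure.sum fun v => clockLaw N β {ω | process u t ω = some v} • Measure.dirac v

/-- A measure is invariant for the process if every transition kernel preserves it. -/
def IsInvariant {N : ℕ} (β : ℝ) (μ : Measure (Lists N)) : Prop :=
  ∀ t : ℝ, 0 ≤ t → Kernel.Invariant (transition N β t) μ

end

end SocialPressure

/-!
The total rate `q(u)` at which a list `u` is left is at least `1`. Write
`p(u, i) = rate β u i / q(u)` for the transition probabilities of the embedded chain. Everything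
rests on a Doeblin condition for this chain (`exists_reach_ladder`): there is one list that is
reached in exactly `2N` steps from every list with a probability bounded below. During `N` steps in
which an actor under the largest pressure speaks in the direction of this pressure, which has
probability at least `1 / (2N)` at each step, all pressures become at most `N` in absolute value.
Then no mark is unlikely, and if the actors express the opinion `+1` one after the other, the list
`(N - 1, …, 1, 0)` results, whatever the list was before.

The law of the process enters only through `lintegral_first_step`: the first mark and the first
waiting time have joint density `rate β u i * exp (-q(u) s)`, and the clocks used afterwards are
independent of them and distributed as all the clocks.

* Non-explosion (`ae_tendsto_jumpTime`): by first-step analysis, the Laplace transform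
  `E (exp (-T n))` is the mass that survives `n` steps of the embedded chain when a jump from `u`
  survives with probability `q(u) / (q(u) + 1)`. By the Doeblin condition it decays geometrically,
  hence `∑ n, exp (-T n)` is almost surely finite and `T n` tends to infinity.
* Uniqueness (`isInvariant_unique`): the transition kernel at time `2N` inherits a column that is
  bounded below (`le_transProb_of_reach`), and a stochastic matrix with such a column has at most
  one invariant probability vector (`eq_of_invariant_of_le`).
* Existence (`exists_isInvariant`): the mean numbers of visits during an excursion of the embedded
  chain from the distinguished list form a measure `ν` which is finite, by the same geometric decay,
  and invariant for the embedded chain. Then `μ(u) = ν(u) / q(u)` is finite because `q ≥ 1`. Sum the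
  integrated backward equation `transProb_add_lintegral` against `μ`: since `μ q = ν` is invariant
  for the embedded chain, the two integrals are equal and finite, so that they cancel, and
  what is left is the invariance of `μ` for the process.
-/

namespace SocialPressure

noncomputable section

open scoped ENNReal

variable {N : ℕ} {β : ℝ}

/-! ### The embedded chain reaches one list uniformly from everywhere -/

/-- The total rate `q(u)` at which the process leaves the list `u`. -/
def totalRate (β : ℝ) (u : Lists N) : ℝ := ∑ i, rate β u i

lemma rate_pos (β : ℝ) (u : Lists N) (i : Mark N) : 0 < rate β u i := Real.exp_pos _

lemma one_le_totalRate (β : ℝ) (u : Lists N) : 1 ≤ totalRate β u := by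
  obtain ⟨a, ha⟩ := u.2
  have h : rate β u (a, 1) = 1 := by simp [rate, ha]
  rw [← h]
  exact Finset.single_le_sum (f := rate β u) (fun i _ => (rate_pos β u i).le) (Finset.mem_univ _)

lemma totalRate_pos (β : ℝ) (u : Lists N) : 0 < totalRate β u :=
  one_pos.trans_le (one_le_totalRate β u)

/-- `Reach β δ n u v`: the list `v` can be reached from `u` by `n` marks in such a way that each of
them has, at its turn, at least the fraction `δ` of the total rate. -/
def Reach (β δ : ℝ) : ℕ → Lists N → Lists N → Prop
  | 0, u, v => u = v
  | n + 1, u, v => ∃ i, δ * totalRate β u ≤ rate β u i ∧ Reach β δ n (push i u) v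

lemma Reach.append {δ : ℝ} {m n : ℕ} {u v w : Lists N} (h : Reach β δ m u v)
    (h' : Reach β δ n v w) : Reach β δ (m + n) u w := by
  induction m generalizing u with
  | zero => cases h; simpa using h'
  | succ m ih =>
    obtain ⟨i, hi, h⟩ := h
    rw [Nat.add_right_comm]
    exact ⟨i, hi, ih h⟩

lemma Reach.snoc {δ : ℝ} {m : ℕ} {u v : Lists N} (h : Reach β δ m u v) {i : Mark N}
    (hi : δ * totalRate β v ≤ rate β v i) : Reach β δ (m + 1) u (push i v) :=
  h.append (n := 1) ⟨i, hi, rfl⟩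

lemma push_apply_self (i : Mark N) (u : Lists N) : (push i u).1 i.1 = 0 := by simp [push]

lemma push_apply_of_ne {i : Mark N} {u : Lists N} {b : Fin N} (h : b ≠ i.1) :
    (push i u).1 b = u.1 b + (i.2 : ℤ) := by simp [push, h]

lemma abs_opinion (o : ℤˣ) : |(o : ℤ)| = 1 := Int.isUnit_iff_abs_eq.1 o.isUnit

lemma abs_push_apply_le (i : Mark N) (u : Lists N) (b : Fin N) :
    |(push i u).1 b| ≤ |u.1 b| + 1 := by
  by_cases h : b = i.1
  · subst h; rw [push_apply_self]; simp; positivity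
  · rw [push_apply_of_ne h]
    refine (abs_add_le _ _).trans (by simp [abs_opinion])

lemma card_mark : (Fintype.card (Mark N) : ℝ) = 2 * N := by
  simp [Mark, mul_comm]

lemma exponent_le (hβ : 0 ≤ β) {u : Lists N} {M : ℕ} (h : ∀ b, |u.1 b| ≤ M) (i : Mark N) :
    |β * ((i.2 : ℤ) : ℝ) * (u.1 i.1 : ℝ)| ≤ M * β := by
  have h1 : |(((i.2 : ℤ)) : ℝ)| = 1 := by
    rw [← Int.cast_abs, abs_opinion]; simp
  have h2 : |((u.1 i.1 : ℤ) : ℝ)| ≤ M := by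
    rw [← Int.cast_abs]; exact_mod_cast h i.1
  rw [abs_mul, abs_mul, h1, abs_of_nonneg hβ, mul_one, mul_comm]
  gcongr

/-- While all pressures are at most `M`, no mark is unlikely. -/
lemma le_rate_of_abs_le (hN : 0 < N) (hβ : 0 ≤ β) {u : Lists N} {M : ℕ} (h : ∀ b, |u.1 b| ≤ M)
    (i : Mark N) : Real.exp (-(2 * M * β)) / (2 * N) * totalRate β u ≤ rate β u i := by
  have hq : totalRate β u ≤ 2 * N * Real.exp (M * β) := by
    rw [← card_mark, ← nsmul_eq_mul]
    refine Finset.sum_le_card_nsmul _ _ _ fun j _ => ?_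
    exact Real.exp_le_exp.2 ((le_abs_self _).trans (exponent_le hβ h j))
  have hr : Real.exp (-(M * β)) ≤ rate β u i :=
    Real.exp_le_exp.2 (abs_le.1 (exponent_le hβ h i)).1
  have hN' : (0 : ℝ) < N := by exact_mod_cast hN
  calc Real.exp (-(2 * M * β)) / (2 * N) * totalRate β u
      ≤ Real.exp (-(2 * M * β)) / (2 * N) * (2 * N * Real.exp (M * β)) := by gcongr
    _ = Real.exp (-(M * β)) := by
        rw [show -((M : ℝ) * β) = -(2 * M * β) + M * β by ring, Real.exp_add]
        field_simp
    _ ≤ _ := hr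

/-- An actor under the largest pressure expresses the opinion that this pressure pushes towards
with at least the average probability `1 / (2N)`. -/
lemma exists_dominant_mark (hβ : 0 ≤ β) (u : Lists N) :
    ∃ i : Mark N, 1 / (2 * N) * totalRate β u ≤ rate β u i ∧ ∀ b, |u.1 b| ≤ |u.1 i.1| := by
  have : Nonempty (Fin N) := ⟨u.2.choose⟩
  obtain ⟨i, hi⟩ := Finite.exists_max fun i : Mark N => (i.2 : ℤ) * u.1 i.1
  refine ⟨i, ?_, fun b => ?_⟩
  · rw [← card_mark, one_div, inv_mul_le_iff₀ (by exact_mod_cast Fintype.card_pos),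
      ← nsmul_eq_mul]
    refine Finset.sum_le_card_nsmul _ _ _ fun j _ => Real.exp_le_exp.2 ?_
    rw [mul_assoc, mul_assoc]
    exact mul_le_mul_of_nonneg_left (by exact_mod_cast hi j) hβ
  · have h1 := hi (b, 1)
    have h2 := hi (b, -1)
    have h3 : (i.2 : ℤ) * u.1 i.1 ≤ |u.1 i.1| := by
      refine (le_abs_self _).trans ?_
      rw [abs_mul, abs_opinion, one_mul]
    push_cast at h1 h2
    exact abs_le.2 ⟨by linarith, by linarith⟩

/-- After `k` steps in which the actor under the largest pressure speaks, either all pressures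
are at most `k`, or `k` different actors have spoken. -/
lemma exists_reach_abs_le {δ : ℝ} (hδ : δ ≤ 1 / (2 * N)) (hβ : 0 ≤ β) (u : Lists N) (k : ℕ) :
    ∃ v, Reach β δ k u v ∧ ((∀ b, |v.1 b| ≤ k) ∨
      ∃ A : Finset (Fin N), A.card = k ∧ ∀ a ∈ A, |v.1 a| ≤ k) := by
  induction k with
  | zero => exact ⟨u, rfl, .inr ⟨∅, by simp⟩⟩
  | succ k ih =>
    obtain ⟨v, huv, hv⟩ := ih
    obtain ⟨i, hi, hmax⟩ := exists_dominant_mark hβ v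
    refine ⟨push i v, huv.snoc (le_trans ?_ hi), ?_⟩
    · exact mul_le_mul_of_nonneg_right hδ (totalRate_pos β v).le
    have step : ∀ b, |v.1 b| ≤ k → |(push i v).1 b| ≤ (k + 1 : ℕ) := fun b hb =>
      (abs_push_apply_le i v b).trans (by push_cast; linarith)
    rcases hv with hv | ⟨A, hA, hAk⟩
    · exact .inl fun b => step b (hv b)
    by_cases hiA : i.1 ∈ A
    · exact .inl fun b => step b ((hmax b).trans (hAk _ hiA))
    · refine .inr ⟨insert i.1 A, by rw [Finset.card_insert_of_notMem hiA, hA], fun a ha => ?_⟩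
      rcases Finset.mem_insert.1 ha with rfl | ha
      · rw [push_apply_self]; simp; positivity
      · exact step a (hAk a ha)

/-- The list `(N - 1, …, 1, 0)`, which is reached whenever the actors express the opinion `+1`
one after the other. -/
def ladder (hN : 0 < N) : Lists N :=
  ⟨fun b => (N : ℤ) - 1 - b, ⟨N - 1, by omega⟩, by simp; omega⟩

lemma exists_reach_partial_ladder {δ : ℝ} (hN : 0 < N)
    (hδ : δ ≤ Real.exp (-(2 * (2 * N : ℕ) * β)) / (2 * N))
    (hβ : 0 ≤ β) {u : Lists N} (hu : ∀ b, |u.1 b| ≤ N) (k : ℕ) (hk : k ≤ N) :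
    ∃ v, Reach β δ k u v ∧
      ∀ b : Fin N, v.1 b = if (b : ℕ) < k then (k : ℤ) - 1 - b else u.1 b + k := by
  induction k with
  | zero => exact ⟨u, rfl, by simp⟩
  | succ k ih =>
    obtain ⟨v, huv, hv⟩ := ih (by omega)
    have hvN : ∀ b, |v.1 b| ≤ (2 * N : ℕ) := fun b => by
      have := abs_le.1 (hu b)
      rw [hv, abs_le]
      push_cast
      have := b.2
      split_ifs <;> constructor <;> omega
    refine ⟨push (⟨k, hk⟩, 1) v, huv.snoc ?_, fun b => ?_⟩
    · exact (mul_le_mul_of_nonneg_right hδ (totalRate_pos β v).le).trans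
        (le_rate_of_abs_le hN hβ hvN _)
    · by_cases hb : b = ⟨k, hk⟩
      · subst hb
        rw [push_apply_self (⟨k, hk⟩, 1)]
        simp
      · rw [push_apply_of_ne hb, hv]
        have hb' : (b : ℕ) ≠ k := fun h => hb (Fin.ext h)
        push_cast
        split_ifs <;> omega

/-- Doeblin's condition for the embedded chain: `2N` steps lead from every list to one and the same
list, with probability bounded below uniformly in the initial list. -/
theorem exists_reach_ladder (hN : 0 < N) (hβ : 0 ≤ β) :
    ∃ δ : ℝ, 0 < δ ∧ ∀ u : Lists N, Reach β δ (2 * N) u (ladder hN) := by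
  have hN' : (0 : ℝ) < N := by exact_mod_cast hN
  refine ⟨Real.exp (-(2 * (2 * N : ℕ) * β)) / (2 * N), by positivity, fun u => ?_⟩
  obtain ⟨v, huv, hv⟩ := exists_reach_abs_le (β := β)
    (δ := Real.exp (-(2 * (2 * N : ℕ) * β)) / (2 * N))
    (by gcongr; rw [Real.exp_le_one_iff]; simp; positivity) hβ u N
  have hv' : ∀ b, |v.1 b| ≤ N := by
    rcases hv with hv | ⟨A, hA, hAk⟩
    · exact hv
    · have : A = Finset.univ := Finset.eq_univ_of_card _ (by simpa using hA)
      exact fun b => hAk b (by simp [this])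
  obtain ⟨w, hvw, hw⟩ := exists_reach_partial_ladder hN le_rfl hβ hv' N le_rfl
  have : w = ladder hN := Subtype.ext (funext fun b => by rw [hw]; simp [ladder])
  rw [show 2 * N = N + N from two_mul N, ← this]
  rw [show 2 * N = N + N from two_mul N] at huv hvw
  exact huv.append hvw

/-! ### Independence of the clocks and competing exponential times -/

/-- Reading an infinite product measure along an injection of the index sets gives again a product
measure. -/
lemma map_infinitePi_comp_injective {ι κ E : Type*} [MeasurableSpace E] (μ : ι → Measure E)
    [∀ i, IsProbabilityMeasure (μ i)] {e : κ → ι} (he : Function.Injective e) :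
    (Measure.infinitePi μ).map (fun ω k => ω (e k)) = Measure.infinitePi fun k => μ (e k) := by
  classical
  refine Measure.eq_infinitePi _ fun s t ht => ?_
  have hpre : (fun (ω : ι → E) k => ω (e k)) ⁻¹' Set.pi s t =
      Set.pi (s.map ⟨e, he⟩ : Finset ι) fun i =>
        if h : ∃ k, e k = i then t h.choose else Set.univ := by
    ext ω
    have hc : ∀ k, (⟨k, rfl⟩ : ∃ k', e k' = e k).choose = k := fun k =>
      he (⟨k, rfl⟩ : ∃ k', e k' = e k).choose_spec
    simp [Set.mem_pi, hc]
  rw [Measure.map_apply (by fun_prop) (.pi s.countable_toSet fun i _ => ht i), hpre,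
    Measure.infinitePi_pi, Finset.prod_map]
  · refine Finset.prod_congr rfl fun k _ => ?_
    have hc : (⟨k, rfl⟩ : ∃ k', e k' = e k).choose = k :=
      he (⟨k, rfl⟩ : ∃ k', e k' = e k).choose_spec
    simp [hc]
  · intro i _
    split_ifs
    · exact ht _
    · exact .univ

/-- An infinite product measure over a disjoint union of index sets is a product of two. -/
lemma map_sumElim_prod_infinitePi {κ ι E : Type*} [MeasurableSpace E] (μ : κ ⊕ ι → Measure E)
    [∀ i, IsProbabilityMeasure (μ i)] :
    ((Measure.infinitePi fun k => μ (.inl k)).prod (Measure.infinitePi fun i => μ (.inr i))).map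
      (MeasurableEquiv.sumPiEquivProdPi fun _ : κ ⊕ ι => E).symm = Measure.infinitePi μ := by
  classical
  refine Measure.eq_infinitePi _ fun s t ht => ?_
  have hpre : (MeasurableEquiv.sumPiEquivProdPi fun _ : κ ⊕ ι => E).symm ⁻¹' Set.pi s t =
      Set.pi s.toLeft (fun k => t (.inl k)) ×ˢ Set.pi s.toRight (fun i => t (.inr i)) := by
    ext ω
    simp [Set.mem_pi, MeasurableEquiv.coe_sumPiEquivProdPi_symm]
  rw [MeasurableEquiv.map_apply, hpre, Measure.prod_prod, Measure.infinitePi_pi _ (by simp [ht]),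
    Measure.infinitePi_pi _ (by simp [ht])]
  conv_rhs => rw [← Finset.toLeft_disjSum_toRight (u := s), Finset.prod_disjSum]

/-- The clocks after the first jump: the clocks with the index of the jump shifted by one. -/
def shift (ω : Clocks N) : Clocks N := fun k => ω (k.1 + 1, k.2)

/-- The clocks attached to the initial list are independent of the clocks after the first jump, and
the latter have the same law as all the clocks. -/
lemma map_clockLaw_prod_shift (u : Lists N) :
    (clockLaw N β).map (fun ω => ((fun i => ω (0, u, i)), shift ω)) =
      (Measure.pi fun i => expMeasure (rate β u i)).prod (clockLaw N β) := by
  let e : Mark N ⊕ (ℕ × Lists N × Mark N) → ℕ × Lists N × Mark N :=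
    Sum.elim (fun i => (0, u, i)) fun k => (k.1 + 1, k.2)
  have he : Function.Injective e := by
    refine Function.Injective.sumElim (fun i j h => by simpa using h)
      (fun k l h => by simpa [Prod.ext_iff] using h) fun i k h => by simp at h
  have h1 := map_infinitePi_comp_injective
    (fun k : ℕ × Lists N × Mark N => expMeasure (rate β k.2.1 k.2.2)) he
  have h2 := map_sumElim_prod_infinitePi fun k => expMeasure (rate β (e k).2.1 (e k).2.2)
  rw [← h1] at h2
  have h3 := congrArg (Measure.map (MeasurableEquiv.sumPiEquivProdPi
    fun _ : Mark N ⊕ (ℕ × Lists N × Mark N) => ℝ)) h2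
  rw [MeasurableEquiv.map_map_symm, Measure.map_map (MeasurableEquiv.measurable _) (by fun_prop)]
    at h3
  rw [← Measure.infinitePi_eq_pi]
  exact h3.symm

lemma expMeasure_eq_withDensity (r : ℝ) :
    expMeasure r = volume.withDensity (exponentialPDF r) := rfl

lemma expMeasure_Ici {r s : ℝ} (hr : 0 < r) (hs : 0 ≤ s) :
    expMeasure r (Set.Ici s) = ENNReal.ofReal (Real.exp (-(r * s))) := by
  have := isProbabilityMeasure_expMeasure hr
  have h1 : expMeasure r (Set.Iic s) = ENNReal.ofReal (1 - Real.exp (-(r * s))) := by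
    rw [expMeasure_eq_withDensity, withDensity_apply _ measurableSet_Iic,
      lintegral_exponentialPDF_eq_antiDeriv hr, if_pos hs]
  have h2 : expMeasure r {s} = 0 := by
    rw [expMeasure_eq_withDensity]
    exact withDensity_absolutelyContinuous _ _ (by simp)
  have h3 : Set.Ici s =ᵐ[expMeasure r] Set.Ioi s := by
    have : Set.Ici s = {s} ∪ Set.Ioi s := by rw [Set.union_comm, Set.Ioi_union_left]
    rw [this]
    have : ({s} : Set ℝ) =ᵐ[expMeasure r] (∅ : Set ℝ) := ae_eq_empty.2 h2
    simpa using this.union (ae_eq_refl (Set.Ioi s))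
  rw [measure_congr h3, ← Set.compl_Iic, prob_compl_eq_one_sub measurableSet_Iic, h1,
    ← ENNReal.ofReal_one, ← ENNReal.ofReal_sub _ (by simpa using by positivity)]
  simp

lemma lintegral_expMeasure {r : ℝ} {g : ℝ → ℝ≥0∞} (hg : Measurable g) :
    ∫⁻ s, g s ∂(expMeasure r) =
      ∫⁻ s in Set.Ioi 0, ENNReal.ofReal (r * Real.exp (-(r * s))) * g s := by
  have hm : Measurable (exponentialPDF r) := (measurable_exponentialPDFReal r).ennreal_ofReal
  rw [expMeasure_eq_withDensity, lintegral_withDensity_eq_lintegral_mul _ hm hg,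
    ← setLIntegral_univ, ← Set.Iio_union_Ici (a := (0 : ℝ)),
    lintegral_union measurableSet_Ici (Set.Iio_disjoint_Ici le_rfl)]
  rw [setLIntegral_congr_fun measurableSet_Iio (g := fun _ => 0), lintegral_zero, zero_add,
    ← restrict_Ioi_eq_restrict_Ici]
  · refine setLIntegral_congr_fun measurableSet_Ioi fun s hs => ?_
    simp [exponentialPDF_of_nonneg (le_of_lt hs)]
  · intro s hs
    simp [exponentialPDF_of_neg hs]

/-- Competing exponential clocks: that the clock `i` rings first, and when, has density
`r i * exp (-(∑ j, r j) * s)`. -/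
lemma lintegral_indicator_isMin {ι : Type*} [Fintype ι] {r : ι → ℝ} (hr : ∀ i, 0 < r i)
    (i : ι) {g : ℝ → ℝ≥0∞} (hg : Measurable g) :
    ∫⁻ τ, {τ : ι → ℝ | ∀ j, τ i ≤ τ j}.indicator (fun τ => g (τ i)) τ
        ∂(Measure.pi fun j => expMeasure (r j)) =
      ∫⁻ s in Set.Ioi 0, ENNReal.ofReal (r i * Real.exp (-((∑ j, r j) * s))) * g s := by
  classical
  have := fun j => isProbabilityMeasure_expMeasure (hr j)
  set μ : ι → Measure ℝ := fun j => expMeasure (r j)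
  have hA : MeasurableSet {τ : ι → ℝ | ∀ j, τ i ≤ τ j} := by
    rw [Set.ofPred_forall]
    exact .iInter fun j => measurableSet_le (measurable_pi_apply i) (measurable_pi_apply j)
  have hmp := measurePreserving_piEquivPiSubtypeProd μ (fun j => j = i)
  have hmi : Measurable fun τ => {τ : ι → ℝ | ∀ j, τ i ≤ τ j}.indicator (fun τ => g (τ i)) τ :=
    (hg.comp (measurable_pi_apply i)).indicator hA
  rw [← hmp.symm.lintegral_comp hmi]
  refine (lintegral_prod _ (hmi.comp (MeasurableEquiv.measurable _)).aemeasurable).trans ?_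
  simp only [Function.comp_apply]
  have hu := measurePreserving_piUnique (fun j : {j // j = i} => μ j)
  have hinner : ∀ x : {j // j = i} → ℝ,
      ∫⁻ y, {τ : ι → ℝ | ∀ j, τ i ≤ τ j}.indicator (fun τ => g (τ i))
        ((MeasurableEquiv.piEquivPiSubtypeProd (fun _ : ι => ℝ) fun j => j = i).symm (x, y))
        ∂(Measure.pi fun j : {j // ¬ j = i} => μ j) =
      (fun s => g s * ∏ j : {j // ¬ j = i}, μ j (Set.Ici s)) (x ⟨i, rfl⟩) := by
    intro x
    have : (fun y => {τ : ι → ℝ | ∀ j, τ i ≤ τ j}.indicator (fun τ => g (τ i))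
        ((MeasurableEquiv.piEquivPiSubtypeProd (fun _ : ι => ℝ) fun j => j = i).symm (x, y))) =
        (Set.univ.pi fun _ : {j // ¬ j = i} => Set.Ici (x ⟨i, rfl⟩)).indicator
          fun _ => g (x ⟨i, rfl⟩) := by
      funext y
      have hmem : (MeasurableEquiv.piEquivPiSubtypeProd (fun _ : ι => ℝ) fun j => j = i).symm
          (x, y) ∈ {τ : ι → ℝ | ∀ j, τ i ≤ τ j} ↔
          y ∈ Set.univ.pi fun _ : {j // ¬ j = i} => Set.Ici (x ⟨i, rfl⟩) := by
        simp only [Set.mem_ofPred_eq, Set.mem_pi, Set.mem_univ, true_imp_iff, Set.mem_Ici,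
          MeasurableEquiv.piEquivPiSubtypeProd, MeasurableEquiv.symm_mk, MeasurableEquiv.coe_mk,
          Equiv.piEquivPiSubtypeProd_symm_apply, dite_true]
        constructor
        · intro h j
          simpa [j.2] using h j
        · intro h j
          by_cases hj : j = i
          · subst hj; simp
          · simpa [hj] using h ⟨j, hj⟩
      by_cases h : y ∈ Set.univ.pi fun _ : {j // ¬ j = i} => Set.Ici (x ⟨i, rfl⟩)
      · rw [Set.indicator_of_mem h, Set.indicator_of_mem (hmem.2 h)]
        simp [MeasurableEquiv.piEquivPiSubtypeProd, Equiv.piEquivPiSubtypeProd_symm_apply]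
      · rw [Set.indicator_of_notMem h, Set.indicator_of_notMem (mt hmem.1 h)]
    rw [this, lintegral_indicator_const (.univ_pi fun _ => measurableSet_Ici), Measure.pi_pi]
  have hmeas : Measurable fun s => g s * ∏ j : {j // ¬ j = i}, μ j (Set.Ici s) := by
    refine hg.mul (Finset.measurable_prod _ fun j _ => Antitone.measurable ?_)
    exact fun s t hst => measure_mono (Set.Ici_subset_Ici.2 hst)
  simp_rw [hinner]
  rw [Subsingleton.elim (Fintype.subtypeEq i) (Subtype.fintype fun j => j = i)] at hu
  refine (hu.lintegral_comp hmeas).trans ?_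
  refine (lintegral_expMeasure hmeas).trans ?_
  refine setLIntegral_congr_fun measurableSet_Ioi fun s hs => ?_
  have hs' : 0 ≤ s := le_of_lt hs
  have hprod : ∏ j : {j // ¬ j = i}, μ j (Set.Ici s) =
      ENNReal.ofReal (Real.exp (-((∑ j : {j // ¬ j = i}, r j) * s))) := by
    rw [Finset.prod_congr rfl fun (j : {j // ¬ j = i}) _ => expMeasure_Ici (hr j) hs',
      ← ENNReal.ofReal_prod_of_nonneg fun _ _ => (Real.exp_pos _).le, ← Real.exp_sum,
      Finset.sum_mul, Finset.sum_neg_distrib]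
  have hsum : ∑ j, r j = r i + ∑ j : {j // ¬ j = i}, r j :=
    Fintype.sum_eq_add_sum_subtype_ne r i
  change ENNReal.ofReal (r i * Real.exp (-(r i * s))) * (g s * _) = _
  rw [hprod, mul_left_comm, ← ENNReal.ofReal_mul (mul_nonneg (hr i).le (Real.exp_pos _).le),
    mul_comm, mul_assoc (r i), ← Real.exp_add, hsum]
  congr 4
  ring

/-! ### First-step analysis -/

lemma lintegral_mul_exp_neg {r q : ℝ} (hr : 0 ≤ r) (hq : 0 < q) :
    ∫⁻ s in Set.Ioi 0, ENNReal.ofReal (r * Real.exp (-(q * s))) = ENNReal.ofReal (r / q) := by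
  have := isProbabilityMeasure_expMeasure hq
  have h := lintegral_expMeasure (r := q) (g := fun _ => 1) measurable_const
  rw [lintegral_one, measure_univ] at h
  simp only [mul_one] at h
  have h2 : ∀ s : ℝ, ENNReal.ofReal (r * Real.exp (-(q * s))) =
      ENNReal.ofReal (r / q) * ENNReal.ofReal (q * Real.exp (-(q * s))) := fun s => by
    rw [← ENNReal.ofReal_mul (by positivity)]
    congr 1
    field_simp
  simp_rw [h2]
  rw [lintegral_const_mul _ (by fun_prop), ← h, mul_one]

instance measurableSingletonClass_intUnits : MeasurableSingletonClass ℤˣ where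
  measurableSet_singleton x := ⟨{(x : ℤ)}, measurableSet_singleton _, by ext; simp [Units.ext_iff]⟩

/-- The mark with the smallest clock. A tie, which has probability zero, is resolved by a choice
that depends only on the set of the smallest clocks. -/
def winner (v : Lists N) (τ : Mark N → ℝ) : Mark N := (exists_first v τ).choose

lemma winner_le (v : Lists N) (τ : Mark N → ℝ) (j : Mark N) : τ (winner v τ) ≤ τ j :=
  (exists_first v τ).choose_spec j

lemma first_eq_winner (ω : Clocks N) (n : ℕ) (v : Lists N) :
    first ω n v = winner v fun i => ω (n, v, i) := rfl

lemma measurableSet_isMin (i : Mark N) : MeasurableSet {τ : Mark N → ℝ | ∀ j, τ i ≤ τ j} := by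
  rw [Set.ofPred_forall]
  exact .iInter fun j => measurableSet_le (measurable_pi_apply i) (measurable_pi_apply j)

lemma measurable_winner (v : Lists N) : Measurable (winner v) := by
  classical
  have : Nonempty (Mark N) := ⟨(v.2.choose, 1)⟩
  let g : (Mark N → Prop) → Mark N := fun p =>
    if h : ∃ i, p i then h.choose else Classical.arbitrary _
  have hg : winner v = g ∘ fun τ i => ∀ j, τ i ≤ τ j := by
    funext τ
    exact (dif_pos (exists_first v τ)).symm
  rw [hg]
  refine Measurable.of_discrete.comp (measurable_pi_lambda _ fun i => ?_)
  exact measurableSet_setOfPred.1 (measurableSet_isMin i)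

/-- Almost surely the mark with the smallest clock is `i` as soon as the clock of `i` is smallest.
The two events have the same probability, because the probabilities `rate β v i / totalRate β v`
add up to one. -/
lemma winner_eq_ae (v : Lists N) (i : Mark N) :
    (winner v ⁻¹' {i} : Set (Mark N → ℝ)) =ᵐ[Measure.pi fun i => expMeasure (rate β v i)]
      {τ | ∀ j, τ i ≤ τ j} := by
  set P := Measure.pi fun i => expMeasure (rate β v i)
  have hsub : ∀ i, winner v ⁻¹' {i} ⊆ {τ | ∀ j, τ i ≤ τ j} := by
    rintro i τ rfl
    exact winner_le v τ
  have hP : ∀ i, P {τ | ∀ j, τ i ≤ τ j} = ENNReal.ofReal (rate β v i / totalRate β v) := fun i => by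
    rw [← lintegral_mul_exp_neg (rate_pos β v i).le (totalRate_pos β v),
      ← lintegral_indicator_one (measurableSet_isMin i)]
    refine (lintegral_indicator_isMin (rate_pos β v) i (g := fun _ => 1) measurable_const).trans ?_
    simp [totalRate]
  have hsum : ∑ i, P {τ | ∀ j, τ i ≤ τ j} = 1 := by
    simp_rw [hP]
    rw [← ENNReal.ofReal_sum_of_nonneg fun i _ =>
      div_nonneg (rate_pos β v i).le (totalRate_pos β v).le, ← Finset.sum_div]
    exact (congrArg _ (div_self (totalRate_pos β v).ne')).trans ENNReal.ofReal_one
  have hsum' : ∑ i, P (winner v ⁻¹' {i}) = 1 := by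
    rw [sum_measure_preimage_singleton _ fun i _ => measurable_winner v (measurableSet_singleton i)]
    simp
  refine ae_eq_of_subset_of_measure_ge (hsub i) ?_
    (measurable_winner v (measurableSet_singleton i)).nullMeasurableSet (measure_ne_top _ _)
  by_contra! hlt
  have : ∑ i, P (winner v ⁻¹' {i}) < ∑ i, P {τ | ∀ j, τ i ≤ τ j} :=
by
    rw [← Finset.add_sum_erase _ _ (Finset.mem_univ i),
      ← Finset.add_sum_erase (a := i) _ _ (Finset.mem_univ i)]
    exact ENNReal.add_lt_add_of_lt_of_le
      (ENNReal.sum_ne_top.2 fun _ _ => measure_ne_top _ _) hlt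
      (Finset.sum_le_sum fun i _ => measure_mono (hsub i))
  rw [hsum, hsum'] at this
  exact this.false

@[fun_prop]
lemma measurable_shift : Measurable (shift (N := N)) := by
  unfold shift
  fun_prop

/-- First-step analysis: the first mark `i` and the first waiting time `s` have joint density
`rate β u i * exp (-totalRate β u * s)`, and the clocks after the first jump are independent of
them and have the same law as all the clocks. -/
theorem lintegral_first_step (u : Lists N) {G : Mark N → ℝ → Clocks N → ℝ≥0∞}
    (hG : ∀ i, Measurable (Function.uncurry (G i))) :
    ∫⁻ ω, G (first ω 0 u) (ω (0, u, first ω 0 u)) (shift ω) ∂clockLaw N β =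
      ∑ i, ∫⁻ s in Set.Ioi 0, ENNReal.ofReal (rate β u i * Real.exp (-(totalRate β u * s))) *
        ∫⁻ ω, G i s ω ∂clockLaw N β := by
  classical
  set P := Measure.pi fun i => expMeasure (rate β u i)
  let F : (Mark N → ℝ) × Clocks N → ℝ≥0∞ := fun p =>
    G (winner u p.1) (p.1 (winner u p.1)) p.2
  have hF : Measurable F := by
    have : F = fun p => ∑ i, (winner u ⁻¹' {i}).indicator 1 p.1 * G i (p.1 i) p.2 := by
      funext p
      rw [Finset.sum_eq_single (winner u p.1)]
      · simp [F]
      · intro i _ hi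
        simp [Ne.symm hi]
      · simp
    rw [this]
    refine Finset.measurable_sum _ fun i _ => Measurable.mul ?_ ?_
    · exact (measurable_one.indicator
        (measurable_winner u (measurableSet_singleton i))).comp measurable_fst
    · have : Measurable fun p : (Mark N → ℝ) × Clocks N => (p.1 i, p.2) := by fun_prop
      exact (hG i).comp this
  let g : Mark N → ℝ → ℝ≥0∞ := fun i s => ∫⁻ ω, G i s ω ∂clockLaw N β
  have hg : ∀ i, Measurable (g i) := fun i => (hG i).lintegral_prod_right
  calc ∫⁻ ω, G (first ω 0 u) (ω (0, u, first ω 0 u)) (shift ω) ∂clockLaw N β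
      = ∫⁻ p, F p ∂(P.prod (clockLaw N β)) := by
        rw [← map_clockLaw_prod_shift, lintegral_map hF (by fun_prop)]
        rfl
    _ = ∫⁻ τ, g (winner u τ) (τ (winner u τ)) ∂P := lintegral_prod _ hF.aemeasurable
    _ = ∫⁻ τ, ∑ i, (winner u ⁻¹' {i}).indicator (fun τ => g i (τ i)) τ ∂P := by
        refine lintegral_congr fun τ => ?_
        rw [Finset.sum_eq_single (winner u τ)]
        · simp
        · intro i _ hi
          simp [Ne.symm hi]
        · simp
    _ = ∑ i, ∫⁻ τ, (winner u ⁻¹' {i}).indicator (fun τ => g i (τ i)) τ ∂P :=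
        lintegral_finsetSum _ fun i _ => ((hg i).comp (measurable_pi_apply i)).indicator
          (measurable_winner u (measurableSet_singleton i))
    _ = _ := by
        refine Finset.sum_congr rfl fun i _ => ?_
        rw [lintegral_congr_ae (indicator_ae_eq_of_ae_eq_set (winner_eq_ae u i))]
        exact lintegral_indicator_isMin (rate_pos β u) i (hg i)

lemma measurable_first (n : ℕ) (v : Lists N) : Measurable fun ω : Clocks N => first ω n v := by
  simp_rw [first_eq_winner]
  exact (measurable_winner v).comp (by fun_prop)

lemma measurable_chain (u : Lists N) (n : ℕ) : Measurable fun ω => chain u ω n := by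
  induction n with
  | zero => exact measurable_const
  | succ n ih =>
    have h : Measurable fun p : Clocks N × Lists N => push (first p.1 n p.2) p.2 :=
      measurable_from_prod_countable_left fun v =>
        (Measurable.of_discrete (f := fun i => push i v)).comp (measurable_first n v)
    exact h.comp (measurable_id.prodMk ih)

lemma measurable_jumpTime (u : Lists N) (n : ℕ) : Measurable fun ω => jumpTime u ω n := by
  induction n with
  | zero => exact measurable_const
  | succ n ih =>
    have h1 : Measurable fun p : Clocks N × Mark N × Lists N => p.1 (n, p.2.2, p.2.1) :=
      measurable_from_prod_countable_left fun v => measurable_pi_apply (n, v.2, v.1)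
    have h2 : Measurable fun p : Clocks N × Lists N => first p.1 n p.2 :=
      measurable_from_prod_countable_left fun v => measurable_first n v
    exact ih.add (h1.comp (measurable_id.prodMk
      ((h2.comp (measurable_id.prodMk (measurable_chain u n))).prodMk (measurable_chain u n))))

lemma chain_succ_eq_shift (u : Lists N) (ω : Clocks N) (n : ℕ) :
    chain u ω (n + 1) = chain (push (first ω 0 u) u) (shift ω) n := by
  induction n with
  | zero => rfl
  | succ n ih =>
    rw [chain, ih]
    rfl

lemma jumpTime_succ_eq_shift (u : Lists N) (ω : Clocks N) (n : ℕ) :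
    jumpTime u ω (n + 1) =
      ω (0, u, first ω 0 u) + jumpTime (push (first ω 0 u) u) (shift ω) n := by
  induction n with
  | zero => simp [jumpTime, chain]
  | succ n ih =>
    rw [jumpTime, ih, chain_succ_eq_shift, jumpTime, add_assoc]
    rfl

/-! ### Damped averages and non-explosion -/

/-- The transition operator of the embedded chain: the mean of `f` after one jump from `u`. -/
def average (β : ℝ) (f : Lists N → ℝ≥0∞) (u : Lists N) : ℝ≥0∞ :=
  ∑ i, ENNReal.ofReal (rate β u i / totalRate β u) * f (push i u)

/-- The transition operator of the embedded chain in which a jump from `u` survives with probability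
`c u`. -/
def damped (β : ℝ) (c f : Lists N → ℝ≥0∞) (u : Lists N) : ℝ≥0∞ := c u * average β f u

lemma sum_jumpProb (u : Lists N) : ∑ i, ENNReal.ofReal (rate β u i / totalRate β u) = 1 := by
  rw [← ENNReal.ofReal_sum_of_nonneg fun i _ =>
    div_nonneg (rate_pos β u i).le (totalRate_pos β u).le, ← Finset.sum_div]
  exact (congrArg _ (div_self (totalRate_pos β u).ne')).trans ENNReal.ofReal_one

lemma average_const (a : ℝ≥0∞) (u : Lists N) : average β (fun _ => a) u = a := by
  rw [average, ← Finset.sum_mul, sum_jumpProb, one_mul]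

lemma average_mono {f g : Lists N → ℝ≥0∞} (h : f ≤ g) : average β f ≤ average β g := fun u =>
  Finset.sum_le_sum fun i _ => by gcongr; exact h _

lemma average_const_mul (a : ℝ≥0∞) (f : Lists N → ℝ≥0∞) :
    average β (fun u => a * f u) = fun u => a * average β f u := by
  funext u
  simp only [average, Finset.mul_sum, mul_left_comm]

lemma average_add (f g : Lists N → ℝ≥0∞) :
    average β (fun u => f u + g u) = fun u => average β f u + average β g u := by
  funext u
  simp only [average, ← Finset.sum_add_distrib, mul_add]

lemma average_tsum {ι : Type*} (f : ι → Lists N → ℝ≥0∞) :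
    average β (fun u => ∑' k, f k u) = fun u => ∑' k, average β (f k) u := by
  funext u
  simp only [average, ← ENNReal.tsum_mul_left]
  rw [Summable.tsum_finsetSum fun _ _ => ENNReal.summable]

section Iterate

variable {c : Lists N → ℝ≥0∞}

lemma damped_iterate_mono (n : ℕ) : Monotone (damped β c)^[n] :=
  Monotone.iterate (f := damped β c) (fun _ _ h u => mul_le_mul_right (average_mono h u) (c u)) n

lemma damped_iterate_const_mul (n : ℕ) (a : ℝ≥0∞) (f : Lists N → ℝ≥0∞) :
    (damped β c)^[n] (fun u => a * f u) = fun u => a * (damped β c)^[n] f u := by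
  induction n with
  | zero => rfl
  | succ n ih =>
    rw [Function.iterate_succ_apply', ih, Function.iterate_succ_apply']
    funext u
    rw [damped, average_const_mul, damped, mul_left_comm]

lemma damped_iterate_add (n : ℕ) (f g : Lists N → ℝ≥0∞) :
    (damped β c)^[n] (fun u => f u + g u) =
      fun u => (damped β c)^[n] f u + (damped β c)^[n] g u := by
  induction n with
  | zero => rfl
  | succ n ih =>
    rw [Function.iterate_succ_apply', ih, Function.iterate_succ_apply',
      Function.iterate_succ_apply']
    funext u
    rw [damped, average_add, damped, damped, mul_add]

lemma damped_iterate_tsum (n : ℕ) {ι : Type*} (f : ι → Lists N → ℝ≥0∞) :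
    (damped β c)^[n] (fun u => ∑' k, f k u) = fun u => ∑' k, (damped β c)^[n] (f k) u := by
  induction n with
  | zero => rfl
  | succ n ih =>
    rw [Function.iterate_succ_apply', ih]
    funext u
    rw [damped, average_tsum, ← ENNReal.tsum_mul_left]
    exact tsum_congr fun k => by rw [Function.iterate_succ_apply', damped]

lemma damped_iterate_one_le_one (hc : ∀ u, c u ≤ 1) (n : ℕ) (u : Lists N) :
    (damped β c)^[n] 1 u ≤ 1 := by
  induction n generalizing u with
  | zero => exact le_rfl
  | succ n ih =>
    rw [Function.iterate_succ_apply', damped]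
    refine mul_le_one' (hc u) ((average_mono (g := fun _ => 1) ih u).trans ?_)
    rw [average_const]

/-- If damping occurs at `v`, then some mass is lost by the time that `v` may have been reached. -/
lemma damped_iterate_one_add_le_one {δ : ℝ} (hc : ∀ u, c u ≤ 1) {n : ℕ}
    {u v : Lists N} (h : Reach β δ n u v) :
    (damped β c)^[n + 1] 1 u + ENNReal.ofReal δ ^ n * (1 - c v) ≤ 1 := by
  classical
  induction n generalizing u with
  | zero =>
    cases h
    have : average β 1 v = 1 := average_const 1 v
    simp [damped, this, add_tsub_cancel_of_le (hc v)]
  | succ n ih =>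
    obtain ⟨i, hi, h⟩ := h
    have hδ : ENNReal.ofReal δ ≤ ENNReal.ofReal (rate β u i / totalRate β u) :=
      ENNReal.ofReal_le_ofReal ((le_div_iff₀ (totalRate_pos β u)).2 hi)
    set a := ENNReal.ofReal δ ^ n * (1 - c v)
    set g := (damped β c)^[n + 1] 1
    calc (damped β c)^[n + 1 + 1] 1 u + ENNReal.ofReal δ ^ (n + 1) * (1 - c v)
        ≤ average β g u + ENNReal.ofReal (rate β u i / totalRate β u) * a := by
          rw [Function.iterate_succ_apply', damped, pow_succ', mul_assoc]
          gcongr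
          exact mul_le_of_le_one_left' (hc u)
      _ = ∑ j, ENNReal.ofReal (rate β u j / totalRate β u) *
            (g (push j u) + if j = i then a else 0) := by
          simp [average, mul_add, Finset.sum_add_distrib]
      _ ≤ ∑ j, ENNReal.ofReal (rate β u j / totalRate β u) * 1 := by
          gcongr with j
          split_ifs with hj
          · exact hj ▸ ih h
          · rw [add_zero]
            exact damped_iterate_one_le_one hc (n + 1) (push j u)
      _ = 1 := by simp [sum_jumpProb]

/-- If `v` can be reached from everywhere in `n` steps and is a place where damping occurs, then the
surviving mass decays geometrically, uniformly in the initial list. -/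
lemma exists_tsum_damped_iterate_le {δ : ℝ} (hδ : 0 < δ) (hc : ∀ u, c u ≤ 1) {n : ℕ} {v : Lists N}
    (hv : c v < 1) (h : ∀ u, Reach β δ n u v) :
    ∃ C : ℝ≥0∞, C ≠ ∞ ∧ ∀ u, ∑' m, (damped β c)^[m] 1 u ≤ C := by
  set κ := ENNReal.ofReal δ ^ n * (1 - c v)
  have hκ : κ ≠ 0 := mul_ne_zero (pow_ne_zero _ (by simpa using hδ)) (tsub_pos_of_lt hv).ne'
  have hle : ∀ u, (damped β c)^[n + 1] 1 u + κ ≤ 1 := fun u =>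
    damped_iterate_one_add_le_one hc (h u)
  have hκ1 : κ ≤ 1 := le_add_self.trans (hle v)
  have hstep : ∀ m u, (damped β c)^[m + (n + 1)] 1 u ≤ (1 - κ) * (damped β c)^[m] 1 u := by
    intro m u
    rw [Function.iterate_add_apply, ← congrFun (damped_iterate_const_mul m (1 - κ) 1) u]
    refine damped_iterate_mono m (fun w => ?_) u
    simpa using ENNReal.le_sub_of_add_le_right (ne_top_of_le_ne_top ENNReal.one_ne_top hκ1) (hle w)
  refine ⟨(n + 1 : ℕ) / κ, ENNReal.div_ne_top (ENNReal.natCast_ne_top _) hκ, fun u => ?_⟩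
  refine ENNReal.tsum_le_of_sum_range_le fun M => ?_
  set a : ℕ → ℝ≥0∞ := fun m => (damped β c)^[m] 1 u
  set S := ∑ m ∈ Finset.range M, a m
  have hfin : ∀ K, ∑ m ∈ Finset.range K, a m ≤ K := fun K => by
    refine (Finset.sum_le_card_nsmul _ _ 1 fun m _ => damped_iterate_one_le_one hc m u).trans ?_
    simp
  have hS : S ≠ ∞ := ne_top_of_le_ne_top (ENNReal.natCast_ne_top M) (hfin M)
  -- The partial sums `S` satisfy `S ≤ (n + 1) + (1 - κ) * S`, whence `κ * S ≤ n + 1`.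
  have hmain : κ * S + (1 - κ) * S ≤ (n + 1 : ℕ) + (1 - κ) * S := by
    calc κ * S + (1 - κ) * S = S := by rw [← add_mul, add_tsub_cancel_of_le hκ1, one_mul]
      _ ≤ ∑ m ∈ Finset.range (n + 1 + M), a m :=
          Finset.sum_le_sum_of_subset (Finset.range_mono (by omega))
      _ = ∑ m ∈ Finset.range (n + 1), a m + ∑ m ∈ Finset.range M, a (n + 1 + m) :=
          Finset.sum_range_add _ _ _
      _ ≤ (n + 1 : ℕ) + (1 - κ) * S := by
          refine add_le_add (hfin _) ?_
          rw [Finset.mul_sum]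
          exact Finset.sum_le_sum fun m _ => by simpa only [a, add_comm (n + 1)] using hstep m u
  rw [ENNReal.le_div_iff_mul_le (.inl hκ) (.inl (ne_top_of_le_ne_top ENNReal.one_ne_top hκ1)),
    mul_comm]
  exact (ENNReal.add_le_add_iff_right (ENNReal.mul_ne_top (by simp) hS)).1 hmain

end Iterate

/-- The Laplace transform of the jump times: a jump from `u` contributes the factor
`totalRate β u / (totalRate β u + 1)`. -/
lemma lintegral_exp_neg_jumpTime (u : Lists N) (n : ℕ) :
    ∫⁻ ω, ENNReal.ofReal (Real.exp (-jumpTime u ω n)) ∂clockLaw N β =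
      (damped β fun u => ENNReal.ofReal (totalRate β u / (totalRate β u + 1)))^[n] 1 u := by
  induction n generalizing u with
  | zero => simp [jumpTime]
  | succ n ih =>
    have hq := totalRate_pos β u
    have hG : ∀ i, Measurable (Function.uncurry fun (s : ℝ) (ω : Clocks N) =>
        ENNReal.ofReal (Real.exp (-(s + jumpTime (push i u) ω n)))) := fun i => by
      have := measurable_jumpTime (push i u) n
      fun_prop
    simp_rw [jumpTime_succ_eq_shift]
    rw [lintegral_first_step u (G := fun i s ω =>
      ENNReal.ofReal (Real.exp (-(s + jumpTime (push i u) ω n)))) hG,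
      Function.iterate_succ_apply', damped, average, Finset.mul_sum]
    refine Finset.sum_congr rfl fun i _ => ?_
    have hr := rate_pos β u i
    have h1 : ∀ s : ℝ, ENNReal.ofReal (rate β u i * Real.exp (-(totalRate β u * s))) *
        ∫⁻ ω, ENNReal.ofReal (Real.exp (-(s + jumpTime (push i u) ω n))) ∂clockLaw N β =
        ENNReal.ofReal (rate β u i * Real.exp (-((totalRate β u + 1) * s))) *
          ∫⁻ ω, ENNReal.ofReal (Real.exp (-jumpTime (push i u) ω n)) ∂clockLaw N β := by
      intro s
      have hm := measurable_jumpTime (push i u) n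
      rw [← lintegral_const_mul _ (by fun_prop), ← lintegral_const_mul _ (by fun_prop)]
      refine lintegral_congr fun ω => ?_
      rw [← ENNReal.ofReal_mul (by positivity), ← ENNReal.ofReal_mul (by positivity), mul_assoc,
        mul_assoc, ← Real.exp_add, ← Real.exp_add]
      congr 3
      ring
    simp_rw [h1]
    rw [lintegral_mul_const _ (by fun_prop), lintegral_mul_exp_neg hr.le (by linarith), ih,
      ← mul_assoc, ← ENNReal.ofReal_mul (by positivity)]
    congr 2
    field_simp

/-- The process does not explode. Indeed the Laplace transforms of the jump times are summable. -/
theorem ae_tendsto_jumpTime (hN : 0 < N) (hβ : 0 ≤ β) (u : Lists N) :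
    ∀ᵐ ω ∂clockLaw N β, Filter.Tendsto (jumpTime u ω) Filter.atTop Filter.atTop := by
  obtain ⟨δ, hδ, hreach⟩ := exists_reach_ladder hN hβ
  have hlt : ∀ u : Lists N, ENNReal.ofReal (totalRate β u / (totalRate β u + 1)) < 1 := fun u => by
    have := totalRate_pos β u
    rw [ENNReal.ofReal_lt_one, div_lt_one (by linarith)]
    linarith
  obtain ⟨C, hC, hle⟩ := exists_tsum_damped_iterate_le hδ (fun u => (hlt u).le) (hlt _) hreach
  have hm := measurable_jumpTime u
  have hint : ∫⁻ ω, ∑' n, ENNReal.ofReal (Real.exp (-jumpTime u ω n)) ∂clockLaw N β ≠ ∞ := by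
    rw [lintegral_tsum fun n => by have := hm n; fun_prop]
    simp_rw [lintegral_exp_neg_jumpTime]
    exact ne_top_of_le_ne_top hC (hle u)
  filter_upwards [ae_lt_top (.tsum fun n => by have := hm n; fun_prop) hint] with ω hω
  have h0 := ENNReal.tendsto_atTop_zero_of_tsum_ne_top hω.ne
  rw [← ENNReal.ofReal_zero] at h0
  have h1 := (ENNReal.tendsto_toReal (by simp)).comp h0
  have h2 : Filter.Tendsto (fun n => Real.exp (-jumpTime u ω n)) Filter.atTop (nhds 0) := by
    simpa [Function.comp_def, ENNReal.toReal_ofReal (Real.exp_pos _).le] using h1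
  exact Filter.tendsto_neg_atBot_iff.1 (Real.tendsto_exp_comp_nhds_zero.1 h2)

lemma iSup_jumpTime_eq_top {u : Lists N} {ω : Clocks N}
    (h : Filter.Tendsto (jumpTime u ω) Filter.atTop Filter.atTop) :
    (⨆ m : ℕ, ((jumpTime u ω (m + 1) : ℝ) : EReal)) = ⊤ := by
  refine iSup_eq_top.2 fun b hb => ?_
  obtain ⟨x, hx, -⟩ := EReal.lt_iff_exists_real_btwn.1 hb
  obtain ⟨m, hm⟩ := ((Filter.tendsto_add_atTop_iff_nat 1).2 h |>.eventually_gt_atTop x).exists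
  exact ⟨m, hx.trans (EReal.coe_lt_coe_iff.2 hm)⟩

lemma isSome_process {u : Lists N} {ω : Clocks N}
    (h : Filter.Tendsto (jumpTime u ω) Filter.atTop Filter.atTop) {t : ℝ} (ht : 0 ≤ t) :
    (process u t ω).isSome := by
  classical
  have hex : ∃ m, t < jumpTime u ω (m + 1) :=
    ((Filter.tendsto_add_atTop_iff_nat 1).2 h |>.eventually_gt_atTop t).exists
  have : ∃ m, jumpTime u ω m ≤ t ∧ t < jumpTime u ω (m + 1) := by
    refine ⟨Nat.find hex, ?_, Nat.find_spec hex⟩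
    rcases hk : Nat.find hex with _ | k
    · simpa [jumpTime] using ht
    · exact not_lt.1 (Nat.find_min hex (m := k) (by omega))
  simp [process, this]

/-! ### Transition probabilities and the backward equation -/

lemma process_eq_some_iff {u v : Lists N} {t : ℝ} {ω : Clocks N} :
    process u t ω = some v ↔ ∃ m, (jumpTime u ω m ≤ t ∧ t < jumpTime u ω (m + 1)) ∧
      (∀ k < m, ¬ (jumpTime u ω k ≤ t ∧ t < jumpTime u ω (k + 1))) ∧ chain u ω m = v := by
  classical
  constructor
  · intro h
    rw [process] at h
    split_ifs at h with hex
    exact ⟨Nat.find hex, Nat.find_spec hex, fun k hk => Nat.find_min hex hk, Option.some.inj h⟩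
  · rintro ⟨m, hm, hmin, rfl⟩
    have hex : ∃ m, jumpTime u ω m ≤ t ∧ t < jumpTime u ω (m + 1) := ⟨m, hm⟩
    rw [process, dif_pos hex, (Nat.find_eq_iff hex).2 ⟨hm, hmin⟩]

lemma measurableSet_process (u v : Lists N) :
    MeasurableSet {p : ℝ × Clocks N | process u p.1 p.2 = some v} := by
  have hT : ∀ m, Measurable fun p : ℝ × Clocks N => jumpTime u p.2 m := fun m =>
    (measurable_jumpTime u m).comp measurable_snd
  have hI : ∀ m, MeasurableSet
      {p : ℝ × Clocks N | jumpTime u p.2 m ≤ p.1 ∧ p.1 < jumpTime u p.2 (m + 1)} := fun m =>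
    (measurableSet_le (hT m) measurable_fst).inter (measurableSet_lt measurable_fst (hT (m + 1)))
  have hJ : ∀ m, MeasurableSet {p : ℝ × Clocks N |
      ∀ k < m, ¬ (jumpTime u p.2 k ≤ p.1 ∧ p.1 < jumpTime u p.2 (k + 1))} := fun m => by
    simp only [Set.ofPred_forall]
    exact .iInter fun k => .iInter fun _ => (hI k).compl
  simp_rw [process_eq_some_iff]
  rw [Set.ofPred_exists]
  exact .iUnion fun m => (hI m).inter ((hJ m).inter
    (((measurable_chain u m).comp measurable_snd) (measurableSet_singleton v)))

/-- Up to the first jump the process stays at its initial list, and afterwards it is the process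
driven by the shifted clocks and started from the list after the first jump. -/
lemma process_eq_some_iff_first_step {u v : Lists N} {t : ℝ} (ht : 0 ≤ t) (ω : Clocks N) :
    process u t ω = some v ↔ (t < ω (0, u, first ω 0 u) ∧ u = v) ∨
      (ω (0, u, first ω 0 u) ≤ t ∧
        process (push (first ω 0 u) u) (t - ω (0, u, first ω 0 u)) (shift ω) = some v) := by
  simp only [process_eq_some_iff]
  have h1 : jumpTime u ω 1 = ω (0, u, first ω 0 u) := by simp [jumpTime, chain]
  have hsucc : ∀ m, (jumpTime u ω (m + 1) ≤ t ∧ t < jumpTime u ω (m + 1 + 1)) ↔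
      (jumpTime (push (first ω 0 u) u) (shift ω) m ≤ t - ω (0, u, first ω 0 u) ∧
        t - ω (0, u, first ω 0 u) < jumpTime (push (first ω 0 u) u) (shift ω) (m + 1)) := by
    intro m
    rw [jumpTime_succ_eq_shift, jumpTime_succ_eq_shift]
    constructor <;> rintro ⟨h, h'⟩ <;> constructor <;> linarith
  constructor
  · rintro ⟨m, hm, hmin, hv⟩
    rcases m with _ | m
    · exact .inl ⟨h1 ▸ hm.2, hv⟩
    · have h0 := hmin 0 (by omega)
      refine .inr ⟨?_, m, (hsucc m).1 hm, fun k hk => ?_, ?_⟩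
      · rw [← h1]
        exact not_lt.1 fun h => h0 ⟨ht, h⟩
      · rw [← hsucc]
        exact hmin (k + 1) (by omega)
      · rw [← chain_succ_eq_shift, hv]
  · rintro (⟨hlt, hv⟩ | ⟨hle, m, hm, hmin, hv⟩)
    · exact ⟨0, ⟨ht, h1.symm ▸ hlt⟩, by simp, hv⟩
    · refine ⟨m + 1, (hsucc m).2 hm, fun k hk => ?_, by rw [chain_succ_eq_shift, hv]⟩
      rcases k with _ | k
      · rw [h1]
        exact fun h => (h.2.trans_le hle).false
      · rw [hsucc]
        exact hmin k (by omega)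

/-- The probability that the process started from `u` is at `v` at time `t`, extended by `0` to
negative times so that convolutions over the whole line can be formed. -/
def transProb (β : ℝ) (v : Lists N) (t : ℝ) (u : Lists N) : ℝ≥0∞ :=
  if 0 ≤ t then clockLaw N β {ω | process u t ω = some v} else 0

lemma transProb_of_nonneg {v : Lists N} {t : ℝ} (ht : 0 ≤ t) (u : Lists N) :
    transProb β v t u = clockLaw N β {ω | process u t ω = some v} := if_pos ht

lemma transProb_of_neg {v : Lists N} {t : ℝ} (ht : t < 0) (u : Lists N) :
    transProb β v t u = 0 := if_neg ht.not_ge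

lemma transProb_le_one (v : Lists N) (t : ℝ) (u : Lists N) : transProb β v t u ≤ 1 := by
  unfold transProb
  split_ifs
  · exact prob_le_one
  · exact zero_le_one

@[fun_prop]
lemma measurable_transProb (u v : Lists N) : Measurable fun t => transProb β v t u := by
  unfold transProb
  exact Measurable.ite measurableSet_Ici
    (measurable_measure_prodMk_left (measurableSet_process u v)) measurable_const

/-- The probability that an exponential time of rate `q` exceeds `s`, extended by `0` to negative
`s`. -/
def survival (q s : ℝ) : ℝ≥0∞ := if 0 ≤ s then ENNReal.ofReal (Real.exp (-(q * s))) else 0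

@[fun_prop]
lemma measurable_survival (q : ℝ) : Measurable (survival q) := by
  unfold survival
  exact Measurable.ite measurableSet_Ici (by fun_prop) measurable_const

lemma ofReal_mul_survival {q : ℝ} (hq : 0 < q) (s : ℝ) :
    ENNReal.ofReal q * survival q s = exponentialPDF q s := by
  rw [exponentialPDF_eq, survival]
  split_ifs
  · rw [ENNReal.ofReal_mul hq.le]
  · simp

lemma survival_add_lintegral {q : ℝ} (hq : 0 < q) (s : ℝ) :
    survival q s + ∫⁻ r in Set.Iic s, ENNReal.ofReal q * survival q r =
      if 0 ≤ s then 1 else 0 := by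
  simp_rw [ofReal_mul_survival hq]
  rw [lintegral_exponentialPDF_eq_antiDeriv hq, survival]
  split_ifs with h
  · rw [← ENNReal.ofReal_add (Real.exp_pos _).le (by simp; positivity)]
    simp
  · simp

/-- The flow of probability `∑ i, rate β u i * P(U_s = v | U_0 = push i u)` that a jump away from
`u` contributes. -/
def inflow (β : ℝ) (v u : Lists N) (s : ℝ) : ℝ≥0∞ :=
  ∑ i, ENNReal.ofReal (rate β u i) * transProb β v s (push i u)

@[fun_prop]
lemma measurable_inflow (u v : Lists N) : Measurable (inflow β v u) := by
  unfold inflow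
  fun_prop

lemma inflow_eq (u v : Lists N) (s : ℝ) :
    inflow β v u s = ENNReal.ofReal (totalRate β u) * average β (transProb β v s) u := by
  rw [inflow, average, Finset.mul_sum]
  refine Finset.sum_congr rfl fun i _ => ?_
  rw [← mul_assoc, ← ENNReal.ofReal_mul (totalRate_pos β u).le,
    mul_div_cancel₀ _ (totalRate_pos β u).ne']

/-- The backward equation in integral form: either there is no jump up to time `t`, or the process
is restarted after the first jump. -/
theorem transProb_eq (u v : Lists N) (t : ℝ) :
    transProb β v t u = survival (totalRate β u) t * (if u = v then 1 else 0) +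
      ∫⁻ s, survival (totalRate β u) s * inflow β v u (t - s) := by
  classical
  set q := totalRate β u with hqdef
  have hq : 0 < q := totalRate_pos β u
  rcases lt_or_ge t 0 with ht | ht
  · rw [transProb_of_neg ht, survival, if_neg ht.not_ge, zero_mul, zero_add]
    refine (lintegral_eq_zero_iff (by fun_prop)).2 (.of_forall fun s => ?_) |>.symm
    rcases lt_or_ge s 0 with hs | hs
    · simp [survival, hs.not_ge]
    · simp [inflow, transProb_of_neg (show t - s < 0 by linarith)]
  -- The indicator of the event `process u t = some v` as a function of the first mark, the first
  -- waiting time and the shifted clocks.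
  let G : Mark N → ℝ → Clocks N → ℝ≥0∞ := fun i s =>
    {ω | (t < s ∧ u = v) ∨ (s ≤ t ∧ process (push i u) (t - s) ω = some v)}.indicator 1
  have hGs : ∀ i, MeasurableSet {p : ℝ × Clocks N |
      (t < p.1 ∧ u = v) ∨ (p.1 ≤ t ∧ process (push i u) (t - p.1) p.2 = some v)} := by
    intro i
    have h1 : Measurable fun p : ℝ × Clocks N => (t - p.1, p.2) := by fun_prop
    exact ((measurableSet_lt measurable_const measurable_fst).inter (.const _)).union
      ((measurableSet_le measurable_fst measurable_const).inter
        (h1 (measurableSet_process (push i u) v)))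
  have hG : ∀ i, Measurable (Function.uncurry (G i)) := fun i =>
    measurable_one.indicator (hGs i)
  have hset : MeasurableSet {ω : Clocks N | process u t ω = some v} :=
    measurable_prodMk_left (measurableSet_process u v)
  have hGi : ∀ i s, ∫⁻ ω, G i s ω ∂clockLaw N β =
      (if t < s ∧ u = v then 1 else 0) + transProb β v (t - s) (push i u) := by
    intro i s
    refine (lintegral_indicator_one (measurable_prodMk_left (hGs i))).trans ?_
    by_cases hs : s ≤ t
    · simp [hs, hs.not_gt, transProb_of_nonneg (sub_nonneg.2 hs)]
    · rw [transProb_of_neg (by linarith)]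
      by_cases huv : u = v
      · simp [not_le.1 hs, huv]
      · simp [hs, huv]
  calc transProb β v t u
      = ∫⁻ ω, G (first ω 0 u) (ω (0, u, first ω 0 u)) (shift ω) ∂clockLaw N β := by
        rw [transProb_of_nonneg ht, ← lintegral_indicator_one hset]
        refine lintegral_congr fun ω => ?_
        simp only [G, Set.indicator_apply, Set.mem_ofPred_eq, process_eq_some_iff_first_step ht ω]
        rfl
    _ = ∑ i, ∫⁻ s in Set.Ioi 0, (ENNReal.ofReal (rate β u i * Real.exp (-(q * s))) *
          (if t < s ∧ u = v then 1 else 0) +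
          ENNReal.ofReal (rate β u i * Real.exp (-(q * s))) *
            transProb β v (t - s) (push i u)) := by
        rw [lintegral_first_step u hG]
        simp_rw [hGi, mul_add, hqdef]
    _ = ∫⁻ s in Set.Ioi 0, (exponentialPDF q s * (if t < s ∧ u = v then 1 else 0) +
          survival q s * inflow β v u (t - s)) := by
        rw [← lintegral_finsetSum]
        · refine setLIntegral_congr_fun measurableSet_Ioi fun s hs => ?_
          have hs' : (0 : ℝ) ≤ s := le_of_lt hs
          simp only [Finset.sum_add_distrib, ← Finset.sum_mul]
          congr 1
          · rw [exponentialPDF_of_nonneg hs', ← ENNReal.ofReal_sum_of_nonneg fun i _ =>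
              mul_nonneg (rate_pos β u i).le (Real.exp_pos _).le, ← Finset.sum_mul]
            rfl
          · rw [inflow, Finset.mul_sum, survival, if_pos hs']
            refine Finset.sum_congr rfl fun i _ => ?_
            rw [ENNReal.ofReal_mul (rate_pos β u i).le]
            ring
        · intro i _
          have : Measurable fun s : ℝ => if t < s ∧ u = v then (1 : ℝ≥0∞) else 0 :=
            Measurable.ite (measurableSet_Ioi.inter (.const _)) measurable_const measurable_const
          fun_prop
    _ = (∫⁻ s in Set.Ioi 0, exponentialPDF q s * (if t < s ∧ u = v then 1 else 0)) +
          ∫⁻ s in Set.Ioi 0, survival q s * inflow β v u (t - s) := by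
        have : Measurable fun s => survival q s * inflow β v u (t - s) := by fun_prop
        exact lintegral_add_right _ this
    _ = _ := by
        refine congrArg₂ (· + ·) ?_ ?_
        · have h1 := expMeasure_Ici hq ht
          have : ∀ s, exponentialPDF q s * (if t < s ∧ u = v then 1 else 0) =
              (Set.Ioi t).indicator (exponentialPDF q) s * (if u = v then 1 else 0) := fun s => by
            by_cases hs : t < s <;> by_cases huv : u = v <;> simp [hs, huv]
          simp_rw [this]
          have hm : Measurable (exponentialPDF q) :=
            (measurable_exponentialPDFReal q).ennreal_ofReal
          rw [lintegral_mul_const _ (hm.indicator measurableSet_Ioi),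
            setLIntegral_indicator measurableSet_Ioi, Set.Ioi_inter_Ioi, sup_eq_left.2 ht,
            restrict_Ioi_eq_restrict_Ici, survival, if_pos ht, ← h1, expMeasure_eq_withDensity,
            withDensity_apply _ measurableSet_Ici]
        · rw [restrict_Ioi_eq_restrict_Ici, ← lintegral_indicator measurableSet_Ici]
          refine lintegral_congr fun s => ?_
          by_cases hs : 0 ≤ s
          · simp [hs]
          · simp [hs, survival]

/-- Kolmogorov's backward equation, integrated over time and written without subtraction. -/
theorem transProb_add_lintegral (u v : Lists N) {t : ℝ} (ht : 0 ≤ t) :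
    transProb β v t u + ∫⁻ r in Set.Iic t, ENNReal.ofReal (totalRate β u) * transProb β v r u =
      (if u = v then 1 else 0) + ∫⁻ r in Set.Iic t, inflow β v u r := by
  set q := totalRate β u
  have hq : 0 < q := totalRate_pos β u
  set d : ℝ≥0∞ := if u = v then 1 else 0
  have hconv : ∀ r, transProb β v r u =
      survival q r * d + ∫⁻ s, inflow β v u s * survival q (r - s) := fun r => by
    rw [transProb_eq, ← lintegral_sub_left_eq_self _ r]
    simp only [sub_sub_cancel, mul_comm, q, d]
  -- Both integrals over time are convolutions of the inflow, and `survival q` plus its integral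
  -- times `q` is the indicator of the nonnegative reals.
  have hswap : ∫⁻ r in Set.Iic t, ENNReal.ofReal q *
      ∫⁻ s, inflow β v u s * survival q (r - s) =
      ∫⁻ s, inflow β v u s * ∫⁻ r in Set.Iic (t - s), ENNReal.ofReal q * survival q r := by
    have h1 : ∀ r, ENNReal.ofReal q * ∫⁻ s, inflow β v u s * survival q (r - s) =
        ∫⁻ s, inflow β v u s * (ENNReal.ofReal q * survival q (r - s)) := fun r => by
      rw [← lintegral_const_mul _ (by fun_prop)]
      exact lintegral_congr fun s => by ring
    simp_rw [h1]
    rw [lintegral_lintegral_swap (by fun_prop)]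
    refine lintegral_congr fun s => ?_
    rw [lintegral_const_mul _ (by fun_prop)]
    congr 1
    rw [← lintegral_indicator measurableSet_Iic, ← lintegral_indicator measurableSet_Iic,
      ← lintegral_sub_right_eq_self ((Set.Iic (t - s)).indicator _) s]
    refine lintegral_congr fun r => ?_
    simp [Set.indicator_apply]
  have hsplit : ∫⁻ r in Set.Iic t, ENNReal.ofReal q * transProb β v r u =
      (∫⁻ r in Set.Iic t, ENNReal.ofReal q * survival q r) * d +
        ∫⁻ s, inflow β v u s * ∫⁻ r in Set.Iic (t - s), ENNReal.ofReal q * survival q r := by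
    rw [← hswap, ← lintegral_mul_const _ (by fun_prop), ← lintegral_add_left (by fun_prop)]
    refine lintegral_congr fun r => ?_
    rw [hconv, mul_add, mul_assoc]
  rw [hsplit, hconv t, add_add_add_comm, ← add_mul, survival_add_lintegral hq, if_pos ht, one_mul,
    ← lintegral_add_left (by fun_prop), ← lintegral_indicator measurableSet_Iic]
  congr 1
  refine lintegral_congr fun s => ?_
  rw [← mul_add, survival_add_lintegral hq]
  by_cases hs : s ≤ t <;> simp [hs]

/-! ### The transition kernel -/

lemma tsum_transProb (hN : 0 < N) (hβ : 0 ≤ β) (u : Lists N) {t : ℝ} (ht : 0 ≤ t) :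
    ∑' v, transProb β v t u = 1 := by
  have hm : ∀ v : Lists N, MeasurableSet {ω | process u t ω = some v} := fun v =>
    measurable_prodMk_left (measurableSet_process u v)
  simp_rw [transProb_of_nonneg ht]
  rw [← measure_iUnion _ hm]
  · rw [prob_compl_eq_zero_iff (.iUnion hm) |>.symm, ← mem_ae_iff]
    filter_upwards [ae_tendsto_jumpTime hN hβ u] with ω hω
    obtain ⟨v, hv⟩ := Option.isSome_iff_exists.1 (isSome_process hω ht)
    exact Set.mem_iUnion.2 ⟨v, hv⟩
  · intro v w hvw
    refine Set.disjoint_left.2 fun ω hv hw => hvw ?_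
    have hv' : process u t ω = some v := hv
    exact Option.some.inj (hv'.symm.trans hw)

lemma transition_apply_singleton (u v : Lists N) {t : ℝ} (ht : 0 ≤ t) :
    transition N β t u {v} = transProb β v t u := by
  classical
  rw [transProb_of_nonneg ht]
  change (Measure.sum fun v => clockLaw N β {ω | process u t ω = some v} • Measure.dirac v) {v} = _
  rw [Measure.sum_apply _ (measurableSet_singleton v), tsum_eq_single v]
  · simp
  · intro w hw
    simp [hw]

lemma isInvariant_iff (μ : Measure (Lists N)) :
    IsInvariant β μ ↔ ∀ t, 0 ≤ t → ∀ v, ∑' u, μ {u} * transProb β v t u = μ {v} := by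
  refine forall₂_congr fun t ht => ?_
  rw [Kernel.Invariant, Measure.ext_iff_singleton]
  refine forall_congr' fun v => ?_
  rw [Measure.bind_apply (measurableSet_singleton v) (Kernel.aemeasurable _), lintegral_countable']
  simp_rw [transition_apply_singleton _ v ht, mul_comm]

/-! ### Uniqueness -/

lemma lintegral_survival {q h : ℝ} (hq : 0 < q) (hh : 0 ≤ h) :
    ∫⁻ s in Set.Iic h, ENNReal.ofReal q * survival q s =
      ENNReal.ofReal (1 - Real.exp (-(q * h))) := by
  simp_rw [ofReal_mul_survival hq]
  rw [lintegral_exponentialPDF_eq_antiDeriv hq, if_pos hh]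

/-- Each step of a path costs at most one unit of time, with probability at least
`1 - exp (-1)`; afterwards the process may wait at the end of the path. -/
lemma le_transProb_of_reach {δ : ℝ} (hδ : 0 ≤ δ) {n : ℕ} {u v : Lists N} (h : Reach β δ n u v)
    {t T : ℝ} (hnt : n ≤ t) (htT : t ≤ T) :
    ENNReal.ofReal (δ * (1 - Real.exp (-1))) ^ n *
      ENNReal.ofReal (Real.exp (-(totalRate β v * T))) ≤ transProb β v t u := by
  induction n generalizing u t with
  | zero =>
    cases h
    have ht : 0 ≤ t := by simpa using hnt
    rw [transProb_eq, survival, if_pos ht, if_pos rfl, mul_one, pow_zero, one_mul]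
    refine le_add_right (ENNReal.ofReal_le_ofReal (Real.exp_le_exp.2 ?_))
    have := totalRate_pos β v
    gcongr
  | succ n ih =>
    obtain ⟨i, hi, h⟩ := h
    push_cast at hnt
    set q := totalRate β u with hqdef
    have hq : 0 < q := totalRate_pos β u
    set a := ENNReal.ofReal (δ * (1 - Real.exp (-1))) ^ n *
      ENNReal.ofReal (Real.exp (-(totalRate β v * T)))
    have hin : ∀ s ∈ Set.Iic (1 : ℝ), survival q s * (ENNReal.ofReal (δ * q) * a) ≤
        survival q s * inflow β v u (t - s) := by
      intro s hs
      rcases lt_or_ge s 0 with h0 | h0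
      · simp [survival, h0.not_ge]
      gcongr
      refine le_trans ?_ (Finset.single_le_sum (f := fun i =>
        ENNReal.ofReal (rate β u i) * transProb β v (t - s) (push i u))
        (fun _ _ => zero_le) (Finset.mem_univ i))
      gcongr
      exact ih h (by linarith [Set.mem_Iic.1 hs]) (by linarith)
    calc ENNReal.ofReal (δ * (1 - Real.exp (-1))) ^ (n + 1) *
          ENNReal.ofReal (Real.exp (-(totalRate β v * T)))
        = ENNReal.ofReal (1 - Real.exp (-1)) * (ENNReal.ofReal δ * a) := by
          rw [pow_succ', mul_assoc]
          change _ * a = _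
          rw [ENNReal.ofReal_mul hδ]
          ring
      _ ≤ ENNReal.ofReal (1 - Real.exp (-(q * 1))) * (ENNReal.ofReal δ * a) := by
          gcongr
          simpa using one_le_totalRate β u
      _ = ∫⁻ s in Set.Iic 1, survival q s * (ENNReal.ofReal (δ * q) * a) := by
          rw [← lintegral_survival hq zero_le_one, ← lintegral_mul_const _ (by fun_prop)]
          refine lintegral_congr fun s => ?_
          rw [ENNReal.ofReal_mul hδ]
          ring
      _ ≤ ∫⁻ s in Set.Iic 1, survival q s * inflow β v u (t - s) :=
          setLIntegral_mono' measurableSet_Iic hin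
      _ ≤ ∫⁻ s, survival q s * inflow β v u (t - s) := setLIntegral_le_lintegral _ _
      _ ≤ transProb β v t u := by
          rw [transProb_eq u]
          exact le_add_self

/-- A stochastic matrix with a uniformly charged column has at most one invariant probability
vector. The positive part `a - b` of the difference of two invariant vectors is again invariant,
hence charges the distinguished point unless it vanishes; so does `b - a`; but one of the two
vanishes there. -/
lemma eq_of_invariant_of_le {S : Type*} {p : S → S → ℝ≥0∞} (hp : ∀ u, ∑' v, p u v = 1)
    {w : S} {ε : ℝ≥0∞} (hε : ε ≠ 0) (hw : ∀ u, ε ≤ p u w) {a b : S → ℝ≥0∞}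
    (ha : ∀ v, ∑' u, a u * p u v = a v) (hb : ∀ v, ∑' u, b u * p u v = b v)
    (ha1 : ∑' u, a u = 1) (hb1 : ∑' u, b u = 1) : a = b := by
  have key : ∀ {a b : S → ℝ≥0∞}, (∀ v, ∑' u, a u * p u v = a v) →
      (∀ v, ∑' u, b u * p u v = b v) → ∑' u, a u = 1 → ∑' u, b u = 1 → a w ≤ b w → a = b := by
    intro a b ha hb ha1 hb1 hab
    set d : S → ℝ≥0∞ := fun u => a u - b u
    -- `d` is below its image, which has the same finite total mass.
    have hle : ∀ v, d v ≤ ∑' u, d u * p u v := fun v => by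
      rw [tsub_le_iff_left]
      calc a v = ∑' u, a u * p u v := (ha v).symm
        _ ≤ ∑' u, (b u * p u v + d u * p u v) := by
            refine ENNReal.tsum_le_tsum fun u => ?_
            rw [← add_mul]
            gcongr
            exact le_add_tsub
        _ = b v + ∑' u, d u * p u v := by rw [ENNReal.tsum_add, hb]
    have hmass : ∑' v, ∑' u, d u * p u v = ∑' v, d v := by
      rw [ENNReal.tsum_comm]
      simp_rw [ENNReal.tsum_mul_left, hp, mul_one]
    have hfin : ∑' v, d v ≠ ∞ := ne_top_of_le_ne_top ENNReal.one_ne_top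
      ((ENNReal.tsum_le_tsum fun u => tsub_le_self).trans ha1.le)
    have heq : d w = ∑' u, d u * p u w := by
      by_contra hne
      exact (ENNReal.tsum_lt_tsum hfin hle (lt_of_le_of_ne (hle w) hne)).ne hmass.symm
    have hd0 : ∑' u, d u = 0 := by
      have h0 : ∑' u, d u * p u w = 0 := by rw [← heq]; exact tsub_eq_zero_of_le hab
      have : (∑' u, d u) * ε ≤ 0 := by
        rw [← h0, ← ENNReal.tsum_mul_right]
        gcongr with u
        exact hw u
      simpa [hε] using this
    have hab' : ∀ u, a u ≤ b u := fun u => tsub_eq_zero_iff_le.1 (ENNReal.tsum_eq_zero.1 hd0 u)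
    funext u
    by_contra hne
    exact (ENNReal.tsum_lt_tsum (by rw [ha1]; exact ENNReal.one_ne_top) hab'
      (lt_of_le_of_ne (hab' u) hne)).ne (ha1.trans hb1.symm)
  rcases le_total (a w) (b w) with h | h
  · exact key ha hb ha1 hb1 h
  · exact (key hb ha hb1 ha1 h).symm

theorem isInvariant_unique (hN : 0 < N) (hβ : 0 ≤ β) {μ ν : Measure (Lists N)}
    [IsProbabilityMeasure μ] [IsProbabilityMeasure ν] (hμ : IsInvariant β μ)
    (hν : IsInvariant β ν) : μ = ν := by
  obtain ⟨δ, hδ, hreach⟩ := exists_reach_ladder hN hβ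
  have ht : (0 : ℝ) ≤ (2 * N : ℕ) := Nat.cast_nonneg _
  have hmass : ∀ (μ : Measure (Lists N)) [IsProbabilityMeasure μ], ∑' u, μ {u} = 1 := fun μ _ => by
    have := lintegral_countable' (μ := μ) fun _ => 1
    simpa using this.symm
  refine Measure.ext_of_singleton fun v => congrFun (f := fun v => μ {v}) (g := fun v => ν {v}) ?_ v
  refine eq_of_invariant_of_le (p := fun u v => transProb β v (2 * N : ℕ) u)
    (fun u => tsum_transProb hN hβ u ht) ?_
    (fun u => le_transProb_of_reach hδ.le (hreach u) le_rfl le_rfl)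
    ((isInvariant_iff μ).1 hμ _ ht) ((isInvariant_iff ν).1 hν _ ht) (hmass μ) (hmass ν)
  have : 0 < δ * (1 - Real.exp (-1)) := mul_pos hδ (sub_pos.2 (by simp))
  exact mul_ne_zero (pow_ne_zero _ (by simpa using this)) (by simpa using Real.exp_pos _)

/-! ### Existence -/

open Classical in
/-- The damping which kills the embedded chain as soon as it jumps away from `v`. -/
def killAt (v u : Lists N) : ℝ≥0∞ := if u = v then 0 else 1

/-- The mean of the sum of `f` over the lists which the embedded chain started from `v` visits
after time `0` and up to its first return to `v`. -/
def excursionSum (β : ℝ) (v : Lists N) (f : Lists N → ℝ≥0∞) : ℝ≥0∞ :=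
  ∑' n, average β ((damped β (killAt v))^[n] f) v

lemma killAt_le_one (v u : Lists N) : killAt v u ≤ 1 := by
  unfold killAt; split_ifs <;> simp

lemma excursionSum_add (v : Lists N) (f g : Lists N → ℝ≥0∞) :
    excursionSum β v (fun u => f u + g u) = excursionSum β v f + excursionSum β v g := by
  simp only [excursionSum, damped_iterate_add, average_add, ENNReal.tsum_add]

lemma excursionSum_const_mul (v : Lists N) (a : ℝ≥0∞) (f : Lists N → ℝ≥0∞) :
    excursionSum β v (fun u => a * f u) = a * excursionSum β v f := by
  simp only [excursionSum, damped_iterate_const_mul, average_const_mul, ENNReal.tsum_mul_left]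

lemma excursionSum_tsum {ι : Type*} (v : Lists N) (f : ι → Lists N → ℝ≥0∞) :
    excursionSum β v (fun u => ∑' k, f k u) = ∑' k, excursionSum β v (f k) := by
  simp only [excursionSum, damped_iterate_tsum, average_tsum]
  exact ENNReal.tsum_comm

lemma excursionSum_mono (v : Lists N) : Monotone (excursionSum β v) := fun _ _ h =>
  ENNReal.tsum_le_tsum fun n => average_mono (damped_iterate_mono n h) v

lemma excursionSum_damped_add (v : Lists N) (f : Lists N → ℝ≥0∞) :
    excursionSum β v (damped β (killAt v) f) + average β f v = excursionSum β v f := by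
  rw [excursionSum, excursionSum,
    tsum_eq_zero_add' (f := fun n => average β ((damped β (killAt v))^[n] f) v)
    ENNReal.summable, add_comm]
  rfl

open Classical in
lemma average_eq_damped_add (v : Lists N) (f : Lists N → ℝ≥0∞) :
    average β f = fun u => damped β (killAt v) f u +
      average β f v * if u = v then 1 else 0 := by
  funext u
  by_cases h : u = v
  · simp [damped, killAt, h]
  · simp [damped, killAt, h]

lemma excursionSum_single_self {v : Lists N} (h : excursionSum β v 1 ≠ ∞) :
    open Classical in excursionSum β v (fun u => if u = v then 1 else 0) = 1 := by
  classical
  have h1 : average β (1 : Lists N → ℝ≥0∞) = 1 := funext fun u => average_const 1 u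
  have h2 := excursionSum_damped_add (β := β) v 1
  have h3 := congrArg (excursionSum β v) (average_eq_damped_add (β := β) v 1)
  rw [excursionSum_add, excursionSum_const_mul, h1, ← h2, h1] at h3
  have hfin : excursionSum β v (damped β (killAt v) 1) ≠ ∞ :=
    ne_top_of_le_ne_top h (h2 ▸ le_self_add)
  simpa using ((ENNReal.add_right_inj hfin).1 h3).symm

/-- The excursion measure is invariant for the embedded chain. -/
lemma excursionSum_average {v : Lists N} (h : excursionSum β v 1 ≠ ∞) (f : Lists N → ℝ≥0∞) :
    excursionSum β v (average β f) = excursionSum β v f := by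
  classical
  rw [average_eq_damped_add v f, excursionSum_add, excursionSum_const_mul,
    excursionSum_single_self h, mul_one, excursionSum_damped_add]

lemma excursionSum_one_ne_top (hN : 0 < N) (hβ : 0 ≤ β) :
    excursionSum β (ladder hN) 1 ≠ ∞ := by
  obtain ⟨δ, hδ, hreach⟩ := exists_reach_ladder hN hβ
  obtain ⟨C, hC, hle⟩ := exists_tsum_damped_iterate_le (β := β) hδ (killAt_le_one (ladder hN))
    (v := ladder hN) (by simp [killAt]) hreach
  refine ne_top_of_le_ne_top hC ?_
  rw [excursionSum, ← congrFun (average_tsum _) (ladder hN)]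
  refine (average_mono (g := fun _ => C) hle _).trans_eq ?_
  rw [average_const]

open Classical in
/-- The mean number of visits to `u` during an excursion of the embedded chain from `v`. -/
def excursionWeight (β : ℝ) (v u : Lists N) : ℝ≥0∞ :=
  excursionSum β v fun w => if w = u then 1 else 0

lemma tsum_excursionWeight_mul (v : Lists N) (f : Lists N → ℝ≥0∞) :
    ∑' u, excursionWeight β v u * f u = excursionSum β v f := by
  classical
  simp_rw [mul_comm _ (f _), excursionWeight, ← excursionSum_const_mul]
  rw [← excursionSum_tsum]
  congr 1
  funext w
  rw [tsum_eq_single w]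
  · simp
  · intro u hu
    simp [hu.symm]

/-- The mean time spent at `u` during an excursion from `v`. -/
def excursionTime (β : ℝ) (v u : Lists N) : ℝ≥0∞ :=
  ENNReal.ofReal (totalRate β u)⁻¹ * excursionWeight β v u

lemma excursionTime_mul_totalRate (v u : Lists N) :
    excursionTime β v u * ENNReal.ofReal (totalRate β u) = excursionWeight β v u := by
  rw [excursionTime, mul_right_comm, ← ENNReal.ofReal_mul (inv_nonneg.2 (totalRate_pos β u).le),
    inv_mul_cancel₀ (totalRate_pos β u).ne', ENNReal.ofReal_one, one_mul]

lemma tsum_excursionTime_le (v : Lists N) :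
    ∑' u, excursionTime β v u ≤ excursionSum β v 1 := by
  rw [← tsum_excursionWeight_mul]
  refine ENNReal.tsum_le_tsum fun u => ?_
  rw [excursionTime, Pi.one_apply, mul_one]
  refine mul_le_of_le_one_left' ?_
  rw [ENNReal.ofReal_le_one]
  exact inv_le_one_of_one_le₀ (one_le_totalRate β u)

lemma excursionTime_self_ne_zero {v : Lists N} (h : excursionSum β v 1 ≠ ∞) :
    excursionTime β v v ≠ 0 := by
  refine mul_ne_zero (by simpa using totalRate_pos β v) ?_
  rw [excursionWeight, excursionSum_single_self h]
  exact one_ne_zero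

/-- The mean times spent during an excursion are invariant for the process. When the integrated
backward equation is summed against them, the two integrals agree, because the excursion measure is
invariant for the embedded chain, and they are finite, so that they cancel. -/
lemma tsum_excursionTime_mul_transProb {v : Lists N} (h : excursionSum β v 1 ≠ ∞) {t : ℝ}
    (ht : 0 ≤ t) (w : Lists N) :
    ∑' u, excursionTime β v u * transProb β w t u = excursionTime β v w := by
  classical
  set I := ∫⁻ r in Set.Iic t, excursionSum β v (transProb β w r)
  have hI : I ≠ ∞ := by
    have hle : I ≤ ∫⁻ r in Set.Iic t, (Set.Ici 0).indicator (fun _ => excursionSum β v 1) r := by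
      refine lintegral_mono fun r => ?_
      rcases lt_or_ge r 0 with hr | hr
      · have : transProb (N := N) β w r = fun u => 0 * (1 : Lists N → ℝ≥0∞) u :=
          funext fun u => by rw [transProb_of_neg hr, zero_mul]
        rw [this, excursionSum_const_mul, zero_mul]
        exact zero_le
      · simp only [Set.indicator_of_mem (Set.mem_Ici.2 hr)]
        exact excursionSum_mono v fun u => transProb_le_one w r u
    refine ne_top_of_le_ne_top ?_ hle
    rw [lintegral_indicator_const measurableSet_Ici, Measure.restrict_apply measurableSet_Ici,
      Set.Ici_inter_Iic, Real.volume_Icc]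
    exact ENNReal.mul_ne_top h ENNReal.ofReal_ne_top
  have h1 : ∑' u, excursionTime β v u *
      ∫⁻ r in Set.Iic t, ENNReal.ofReal (totalRate β u) * transProb β w r u = I := by
    simp_rw [← lintegral_const_mul _ ((measurable_transProb _ _).const_mul _)]
    rw [← lintegral_tsum fun u => by fun_prop]
    refine lintegral_congr fun r => ?_
    simp_rw [← mul_assoc, excursionTime_mul_totalRate]
    exact tsum_excursionWeight_mul v _
  have h2 : ∑' u, excursionTime β v u * ∫⁻ r in Set.Iic t, inflow β w u r = I := by
    simp_rw [← lintegral_const_mul _ (measurable_inflow _ _)]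
    rw [← lintegral_tsum fun u => by fun_prop]
    refine lintegral_congr fun r => ?_
    simp_rw [inflow_eq, ← mul_assoc, excursionTime_mul_totalRate]
    rw [tsum_excursionWeight_mul, excursionSum_average h]
  have h3 : ∑' u, excursionTime β v u * (if u = w then 1 else 0) = excursionTime β v w := by
    rw [tsum_eq_single w]
    · simp
    · intro u hu
      simp [hu]
  have h4 : ∑' u, excursionTime β v u * (transProb β w t u +
        ∫⁻ r in Set.Iic t, ENNReal.ofReal (totalRate β u) * transProb β w r u) =
      ∑' u, excursionTime β v u * ((if u = w then 1 else 0) +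
        ∫⁻ r in Set.Iic t, inflow β w u r) :=
    tsum_congr fun u => by rw [transProb_add_lintegral u w ht]
  simp only [mul_add, ENNReal.tsum_add] at h4
  rw [h1, h2, h3] at h4
  exact (ENNReal.add_left_inj hI).1 h4

theorem exists_isInvariant (hN : 0 < N) (hβ : 0 ≤ β) :
    ∃ μ : Measure (Lists N), IsProbabilityMeasure μ ∧ IsInvariant β μ := by
  classical
  set m := excursionTime β (ladder hN)
  have hfin := excursionSum_one_ne_top hN hβ
  have hZ : ∑' u, m u ≠ ∞ := ne_top_of_le_ne_top hfin (tsum_excursionTime_le _)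
  have hZ0 : ∑' u, m u ≠ 0 := fun h =>
    excursionTime_self_ne_zero hfin (ENNReal.tsum_eq_zero.1 h (ladder hN))
  set μ : Measure (Lists N) := Measure.sum fun u => (m u * (∑' u, m u)⁻¹) • Measure.dirac u
  have hμ : ∀ u, μ {u} = m u * (∑' u, m u)⁻¹ := fun u => by
    rw [Measure.sum_apply _ (measurableSet_singleton u), tsum_eq_single u]
    · simp
    · intro w hw
      simp [hw]
  refine ⟨μ, ⟨?_⟩, (isInvariant_iff μ).2 fun t ht v => ?_⟩
  · rw [Measure.sum_apply _ .univ]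
    simp only [Measure.smul_apply, measure_univ, smul_eq_mul, mul_one]
    rw [ENNReal.tsum_mul_right, ENNReal.mul_inv_cancel hZ0 hZ]
  · simp_rw [hμ, mul_right_comm]
    rw [ENNReal.tsum_mul_right, tsum_excursionTime_mul_transProb hfin ht]

end

end SocialPressure

theorem theorem1 (N : ℕ) (hN : 3 ≤ N) (β : ℝ) (hβ : 0 ≤ β) :
    (∀ u : SocialPressure.Lists N,
      (∀ᵐ ω ∂(SocialPressure.clockLaw N β),
        (⨆ m : ℕ, ((SocialPressure.jumpTime u ω (m + 1) : ℝ) : EReal)) = ⊤) ∧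
      (∀ᵐ ω ∂(SocialPressure.clockLaw N β),
        ∀ t : ℝ, 0 ≤ t → (SocialPressure.process u t ω).isSome)) ∧
    (∃! μ : MeasureTheory.ProbabilityMeasure (SocialPressure.Lists N),
      SocialPressure.IsInvariant β (μ : MeasureTheory.Measure (SocialPressure.Lists N))) := by
  have hN' : 0 < N := by omega
  refine ⟨fun u => ⟨?_, ?_⟩, ?_⟩
  · filter_upwards [SocialPressure.ae_tendsto_jumpTime hN' hβ u] with ω hω
    exact SocialPressure.iSup_jumpTime_eq_top hω
  · filter_upwards [SocialPressure.ae_tendsto_jumpTime hN' hβ u] with ω hω t ht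
    exact SocialPressure.isSome_process hω ht
  · obtain ⟨μ, hμ, hinv⟩ := SocialPressure.exists_isInvariant hN' hβ
    refine ⟨⟨μ, hμ⟩, hinv, fun ν hν => Subtype.ext ?_⟩
    have := ν.2
    exact SocialPressure.isInvariant_unique hN' hβ hν hinv
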